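/- Let $T$ be a complete first-order theory with monster model $\mathbb{M}$; below, $x$ and $y$ denote finite tuples of variables, parameters $a_i, b_j, a_{ij}, a_\eta$ are tuples from $\mathbb{M}$ of the length of $y$, and a set of formulas with parameters is consistent if each of its finite subsets is realized in $\mathbb{M}$. An indexed family of formulas is $k$-inconsistent if no $k$ of its members, at distinct indices, are jointly realized. * $T$ is NIP if there are no formula $\varphi(x,y)$ and $(a_i)_{i\in\omega}$ such that for every $s\subseteq\omega$ the set $\{\varphi(x,a_i)\}_{i\in s}\cup\{\neg\varphi(x,a_i)\}_{i\notin s}$ is consistent. * $T$ is simple if no formula has the tree property, that is, if there are no $\varphi(x,y)$, $k\in\omega$ and $(a_\eta)_{\eta\in\omega^{<\omega}}$ such that $\{\varphi(x,a_{\eta^\frown i})\}_{i\in\omega}$ is $k$-inconsistent for every $\eta\in\omega^{<\omega}$, and $\{\varphi(x,a_{\sigma|l})\}_{l\in\omega}$ is consistent for every $\sigma\in\omega^\omega$. * $T$ is $\mathrm{NTP}_2$ if there are no $\varphi(x,y)$, $k\in\omega$ and $(a_{ij})_{i,j\in\omega}$ such that $\{\varphi(x,a_{ij})\}_{j\in\omega}$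 is $k$-inconsistent for every $i\in\omega$, and $\{\varphi(x,a_{if(i)})\}_{i\in\omega}$ is consistent for every $f:\omega\to\omega$. * $T$ is resilient if there are no indiscernible sequences $\bar a=(a_i)_{i\in\mathbb{Z}}$, $\bar b=(b_j)_{j\in\mathbb{Z}}$ and formula $\varphi(x,y)$ such that $a_0=b_0$, $\bar b$ is indiscernible over $(a_i)_{i\neq 0}$, $\{\varphi(x,a_i)\}_{i\in\mathbb{Z}}$ is consistent, and $\{\varphi(x,b_j)\}_{j\in\mathbb{Z}}$ is inconsistent. Then: 1. If $T$ is NIP, then $T$ is resilient. 2. If $T$ is simple, then $T$ is resilient. 3. If $T$ is resilient, then $T$ is $\mathrm{NTP}_2$. -/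

import Mathlib

universe u v w

namespace FirstOrder.Language

section Families

variable {ι X : Type*}

/-- Consistency of a family of conditions `P i` on a point of `X`: every finite subfamily is
realized. When `X = Fin m → M` and each `P i` is defined by a formula with parameters in the
structure `M`, this is the usual notion of consistency of the set of formulas `{P i : i}` (with
the elementary diagram of `M`), that is, realizability in an elementary extension of `M`. -/
def ConsistentFamily (P : ι → X → Prop) : Prop :=
  ∀ s : Finset ι, ∃ d : X, ∀ i ∈ s, P i d

/-- `k`-inconsistency: no `k` members of the family, at distinct indices, hold at once. -/
def KInconsistentFamily (k : ℕ) (P : ι → X → Prop) : Prop :=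
  ∀ s : Finset ι, s.card = k → ¬ ∃ d : X, ∀ i ∈ s, P i d

end Families

section Structures

variable {L : Language.{u, v}} {M : Type w} [L.Structure M] {m n : ℕ}

/-- The instance `φ(x, a)` of `φ(x, y)`, as a condition on the `m`-tuple `x`. -/
def inst (φ : L.Formula (Fin m ⊕ Fin n)) (a : Fin n → M) : (Fin m → M) → Prop :=
  fun d => φ.Realize (Sum.elim d a)

/-- The sequence `(a i)` of `n`-tuples, indexed by a linear order, is indiscernible over the set
of parameters `B`: any two increasing `k`-tuples of members satisfy the same formulas with
parameters in `B` (a formula over `B` is given with its parameters as extra variables). -/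
def IndiscernibleOver (L : Language.{u, v}) {M : Type w} [L.Structure M] {n : ℕ}
    {I : Type*} [LinearOrder I] (a : I → Fin n → M) (B : Set M) : Prop :=
  ∀ (k : ℕ) (ψ : L.Formula ((Fin k × Fin n) ⊕ B)) (s t : Fin k → I),
    StrictMono s → StrictMono t →
      (ψ.Realize (Sum.elim (fun p => a (s p.1) p.2) (fun c => (c : M))) ↔
        ψ.Realize (Sum.elim (fun p => a (t p.1) p.2) (fun c => (c : M))))

/-- The independence property of `φ(x, y)`, witnessed in `M`. -/
def HasIPIn (M : Type w) [L.Structure M] (φ : L.Formula (Fin m ⊕ Fin n)) : Prop :=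
  ∃ a : ℕ → Fin n → M, ∀ s : Set ℕ,
    ConsistentFamily fun (i : ℕ) (d : Fin m → M) => inst φ (a i) d ↔ i ∈ s

/-- The tree property of `φ(x, y)`, witnessed in `M`. Finite sequences of natural numbers are the
nodes of the tree; the nodes on the branch `σ` are the `(σ 0, …, σ (l - 1))`, `l : ℕ`. -/
def HasTPIn (M : Type w) [L.Structure M] (φ : L.Formula (Fin m ⊕ Fin n)) : Prop :=
  ∃ (a : List ℕ → Fin n → M) (k : ℕ),
    (∀ η : List ℕ, KInconsistentFamily k fun i : ℕ => inst φ (a (η ++ [i]))) ∧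
    ∀ σ : ℕ → ℕ, ConsistentFamily fun l : ℕ => inst φ (a ((List.range l).map σ))

/-- The tree property of the second kind of `φ(x, y)`, witnessed in `M`. -/
def HasTP2In (M : Type w) [L.Structure M] (φ : L.Formula (Fin m ⊕ Fin n)) : Prop :=
  ∃ (a : ℕ → ℕ → Fin n → M) (k : ℕ),
    (∀ i : ℕ, KInconsistentFamily k fun j : ℕ => inst φ (a i j)) ∧
    ∀ f : ℕ → ℕ, ConsistentFamily fun i : ℕ => inst φ (a i (f i))

/-- The configuration forbidden in resilient theories, for `φ(x, y)` and witnessed in `M`. -/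
def HasNonresilienceIn (M : Type w) [L.Structure M] (φ : L.Formula (Fin m ⊕ Fin n)) : Prop :=
  ∃ a b : ℤ → Fin n → M,
    IndiscernibleOver L a ∅ ∧
    IndiscernibleOver L b ∅ ∧
    a 0 = b 0 ∧
    IndiscernibleOver L b {c | ∃ i : ℤ, i ≠ 0 ∧ ∃ j : Fin n, a i j = c} ∧
    (ConsistentFamily fun i : ℤ => inst φ (a i)) ∧
    ¬ ConsistentFamily fun j : ℤ => inst φ (b j)

end Structures

/-! Properties of a theory `T`. A configuration occurs in a monster model of a complete theory iff
it occurs in some model of `T`, and then already in one of cardinality at most `|L| + ℵ₀`, hence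
in one that lives in the universe `max u v`. -/

namespace Theory

variable {L : Language.{u, v}} (T : L.Theory)

/-- `T` is NIP: no formula `φ(x, y)` has the independence property. -/
def IsNIP : Prop :=
  ∀ (m n : ℕ) (φ : L.Formula (Fin m ⊕ Fin n)) (M : ModelType.{u, v, max u v} T), ¬ HasIPIn M φ

/-- `T` is simple: no formula `φ(x, y)` has the tree property. -/
def IsSimple : Prop :=
  ∀ (m n : ℕ) (φ : L.Formula (Fin m ⊕ Fin n)) (M : ModelType.{u, v, max u v} T), ¬ HasTPIn M φ

/-- `T` is NTP₂: no formula `φ(x, y)` has the tree property of the second kind. -/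
def IsNTP2 : Prop :=
  ∀ (m n : ℕ) (φ : L.Formula (Fin m ⊕ Fin n)) (M : ModelType.{u, v, max u v} T), ¬ HasTP2In M φ

/-- `T` is resilient. -/
def IsResilient : Prop :=
  ∀ (m n : ℕ) (φ : L.Formula (Fin m ⊕ Fin n)) (M : ModelType.{u, v, max u v} T),
    ¬ HasNonresilienceIn M φ

end Theory

end FirstOrder.Language

/-! Let `a`, `b`, `φ` witness nonresilience. Since `b` is indiscernible over the `a i` with `i ≠ 0`,
and `a 0 = b 0`, any `b j` can replace `a 0` in a formula about members of `a`
(`realize_update_iff`), and shifts let any index play the role of `0`.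

NIP: a point `d` cannot satisfy all `φ(x, b j)`, so replacing `a 0` by a `b j` with `¬φ(d, b j)`
adds a negative condition to any pattern already realized; every finite pattern along `a` arises in
this way (`exists_pattern_of_nonresilience`).

Simplicity: above any finite part of `a`, shifted to negative indices, the `b j` serve as
`k`-inconsistent successors, and each of them continues the branch as `a 0` would
(`realize_treeFormula`). Finite trees of every size with one fixed `k` have an ultrapower limit with
the tree property.

NTP₂: from a TP₂ array, draw `a` from successive generic rows and `b` from generic columns of the
row used for `a 0`. Iterated nonprincipal ultrafilters take the place of Ramsey's theorem: the law
of an increasing subtuple depends only on its length, so the limit is indiscernible. Distinct rows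
make `a` consistent; distinct columns of one row make `b` inconsistent. -/

namespace FirstOrder.Language

/-! ### Formulas on finite families and indiscernible sequences -/

section Resilience

variable {L : Language.{u, v}} {M : Type w} [L.Structure M] {m n : ℕ}

/-- The formula over an indexed family `y` of `n`-tuples which says that some `x` satisfies
`φ(x, y i)` exactly for the `i` in `S`. -/
noncomputable def patternFormula (φ : L.Formula (Fin m ⊕ Fin n)) {ι : Type*} [Finite ι]
    (S : Set ι) : L.Formula (ι × Fin n) :=
  open Classical in
  Formula.iExs (Fin m) (Formula.iInf fun i : ι =>
    if i ∈ S then φ.relabel (Sum.elim Sum.inr fun j => Sum.inl (i, j))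
    else ∼(φ.relabel (Sum.elim Sum.inr fun j => Sum.inl (i, j))))

theorem realize_patternFormula (φ : L.Formula (Fin m ⊕ Fin n)) {ι : Type*} [Finite ι]
    (S : Set ι) (y : ι → Fin n → M) :
    (patternFormula φ S).Realize (fun p => y p.1 p.2) ↔
      ∃ d : Fin m → M, ∀ i, inst φ (y i) d ↔ i ∈ S := by
  classical
  have key (d : Fin m → M) (i : ι) :
      (φ.relabel (Sum.elim Sum.inr fun j => Sum.inl (i, j)) :
        L.Formula ((ι × Fin n) ⊕ Fin m)).Realize (Sum.elim (fun p => y p.1 p.2) d) ↔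
      inst φ (y i) d := by
    rw [Formula.realize_relabel, inst]
    congr! 1
    ext (_ | _) <;> rfl
  rw [patternFormula, Formula.realize_iExs]
  refine exists_congr fun d => ?_
  rw [Formula.realize_iInf]
  refine forall_congr' fun i => ?_
  by_cases hi : i ∈ S
  · simp only [hi, if_true, key, iff_true]
  · simp only [hi, if_false, Formula.realize_not, key, iff_false]

/-- The formula over an indexed family `y` of `n`-tuples which says that the `φ(x, y i)` are
jointly realized. -/
noncomputable def jointFormula (φ : L.Formula (Fin m ⊕ Fin n)) (ι : Type*) [Finite ι] :
    L.Formula (ι × Fin n) :=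
  patternFormula φ Set.univ

theorem realize_jointFormula (φ : L.Formula (Fin m ⊕ Fin n)) {ι : Type*} [Finite ι]
    (y : ι → Fin n → M) :
    (jointFormula φ ι).Realize (fun p => y p.1 p.2) ↔ ∃ d : Fin m → M, ∀ i, inst φ (y i) d := by
  simp [jointFormula, realize_patternFormula]

/-- Indiscernibility for formulas over families of `n`-tuples: replacing the members with indices
`s q` of an indiscernible sequence by those with indices `t q`, and keeping the other tuples of the
family, which lie in the base, does not change the truth of a formula. -/
theorem IndiscernibleOver.realize_iff {I : Type*} [LinearOrder I] {a : I → Fin n → M} {B : Set M}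
    (ha : IndiscernibleOver L a B) {ι : Type*} (ψ : L.Formula (ι × Fin n)) {k : ℕ}
    {s t : Fin k → I} (hs : StrictMono s) (ht : StrictMono t) {y z : ι → Fin n → M}
    (h : ∀ i, (∃ q, y i = a (s q) ∧ z i = a (t q)) ∨ (y i = z i ∧ ∀ j, y i j ∈ B)) :
    ψ.Realize (fun p => y p.1 p.2) ↔ ψ.Realize (fun p => z p.1 p.2) := by
  have h' : ∀ p : ι × Fin n, ∃ r : (Fin k × Fin n) ⊕ B,
      Sum.elim (fun p => a (s p.1) p.2) (fun c : B => (c : M)) r = y p.1 p.2 ∧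
      Sum.elim (fun p => a (t p.1) p.2) (fun c : B => (c : M)) r = z p.1 p.2 := by
    rintro ⟨i, j⟩
    rcases h i with ⟨q, h1, h2⟩ | ⟨h1, h2⟩
    · exact ⟨Sum.inl (q, j), by simp [h1], by simp [h2]⟩
    · exact ⟨Sum.inr ⟨y i j, h2 j⟩, rfl, by simp [h1]⟩
  choose r hr using h'
  have := ha k (ψ.relabel r) s t hs ht
  rw [Formula.realize_relabel, Formula.realize_relabel] at this
  convert this using 2
  · ext p; exact ((hr p).1).symm
  · ext p; exact ((hr p).2).symm

/-- The truth of a formula on members of an indiscernible sequence of order type `ℤ` is invariant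
under shifts. -/
theorem IndiscernibleOver.realize_shift {a : ℤ → Fin n → M} (ha : IndiscernibleOver L a ∅)
    {ι : Type*} [Finite ι] (ψ : L.Formula (ι × Fin n)) (f : ι → ℤ) (c : ℤ) :
    ψ.Realize (fun p => a (f p.1) p.2) ↔ ψ.Realize (fun p => a (f p.1 - c) p.2) := by
  -- `f` may be neither monotone nor injective, so its range is enumerated increasingly.
  have hs := ((Set.finite_range f).toFinset.orderEmbOfFin rfl).strictMono
  refine ha.realize_iff (y := fun i => a (f i)) (z := fun i => a (f i - c)) ψ hs
    (fun p q hpq => sub_lt_sub_right (hs hpq) c) fun i => Or.inl ?_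
  obtain ⟨q, hq⟩ : f i ∈ Set.range ((Set.finite_range f).toFinset.orderEmbOfFin rfl) := by simp
  exact ⟨q, by rw [hq], by rw [hq]⟩

/-! ### From nonresilience to the independence property -/

section Configuration

variable {φ : L.Formula (Fin m ⊕ Fin n)} {a b : ℤ → Fin n → M}

/-- A member of the indiscernible sequence `a` may be replaced by any member of `b` when `b` is
indiscernible over the other members of `a` and passes through that member. -/
theorem realize_update_iff (hab : a 0 = b 0)
    (hb : IndiscernibleOver L b {c | ∃ i : ℤ, i ≠ 0 ∧ ∃ j : Fin n, a i j = c})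
    {ι : Type*} (ψ : L.Formula (ι × Fin n)) (f : ι → ℤ) (j : ℤ) :
    ψ.Realize (fun p => a (f p.1) p.2) ↔
      ψ.Realize (fun p => (if f p.1 = 0 then b j else a (f p.1)) p.2) := by
  refine hb.realize_iff (k := 1) (s := fun _ => 0) (t := fun _ => j)
    (y := fun i => a (f i)) (z := fun i => if f i = 0 then b j else a (f i)) ψ
    (Subsingleton.strictMono _) (Subsingleton.strictMono _) fun i => ?_
  by_cases hi : f i = 0
  · exact Or.inl ⟨0, by simp [hi, hab], by simp [hi]⟩
  · exact Or.inr ⟨by simp [hi], fun j => ⟨f i, hi, j, rfl⟩⟩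

/-- Induction on `F`, removing an index where a negative condition is required; once none is left,
consistency of the instances along `a` suffices. -/
theorem exists_pattern_of_nonresilience (ha : IndiscernibleOver L a ∅) (hab : a 0 = b 0)
    (hb : IndiscernibleOver L b {c | ∃ i : ℤ, i ≠ 0 ∧ ∃ j : Fin n, a i j = c})
    (hca : ConsistentFamily fun i : ℤ => inst φ (a i))
    (hcb : ¬ ConsistentFamily fun j : ℤ => inst φ (b j)) (S : Set ℤ) (F : Finset ℤ) :
    ∃ d : Fin m → M, ∀ i ∈ F, inst φ (a i) d ↔ i ∈ S := by
  classical
  induction F using Finset.strongInduction with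
  | H F ih =>
    by_cases hF : ∀ i ∈ F, i ∈ S
    · obtain ⟨d, hd⟩ := hca F
      exact ⟨d, fun i hi => iff_of_true (hd i hi) (hF i hi)⟩
    push Not at hF
    obtain ⟨p, hp, hpS⟩ := hF
    have toSubtype (G : Finset ℤ) (c : ℤ) :
        (patternFormula φ (Subtype.val ⁻¹' S : Set G)).Realize
          (fun p => a ((p.1 : ℤ) - c) p.2) ↔
        ∃ d : Fin m → M, ∀ i ∈ G, inst φ (a (i - c)) d ↔ i ∈ S :=
      (realize_patternFormula φ _ fun i : G => a (i - c)).trans (by simp)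
    -- Shifting by `p` moves the removed index to `0`, the only place where `b` meets `a`.
    obtain ⟨d, hd⟩ : ∃ d : Fin m → M, ∀ i ∈ F.erase p, inst φ (a (i - p)) d ↔ i ∈ S := by
      rw [← toSubtype, ← ha.realize_shift _ fun i : F.erase p => (i : ℤ)]
      simpa using (toSubtype (F.erase p) 0).2 (by simpa using ih _ (Finset.erase_ssubset hp))
    obtain ⟨j, hj⟩ : ∃ j, ¬ inst φ (b j) d := by
      by_contra! h
      exact hcb fun s => ⟨d, fun i _ => h i⟩
    suffices h : ∃ d : Fin m → M, ∀ i ∈ F, inst φ (a (i - p)) d ↔ i ∈ S by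
      rw [← toSubtype, ← ha.realize_shift _ fun i : F => (i : ℤ)] at h
      simpa using (toSubtype F 0).1 (by simpa using h)
    -- With `b j` in place of `a 0`, the point `d` itself realizes the whole pattern.
    rw [← toSubtype, realize_update_iff hab hb _ (fun i : F => (i : ℤ) - p) j,
      realize_patternFormula φ _ fun i : F => if (i : ℤ) - p = 0 then b j else a (i - p)]
    refine ⟨d, fun ⟨i, hi⟩ => ?_⟩
    by_cases hip : i = p
    · subst hip
      simpa [hpS] using hj
    · simpa [sub_eq_zero, hip] using hd i (Finset.mem_erase.2 ⟨hip, hi⟩)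

theorem HasNonresilienceIn.hasIPIn (h : HasNonresilienceIn M φ) : HasIPIn M φ := by
  obtain ⟨a, b, ha, -, hab, hb, hca, hcb⟩ := h
  refine ⟨fun i => a i, fun S F => ?_⟩
  obtain ⟨d, hd⟩ := exists_pattern_of_nonresilience ha hab hb hca hcb (Nat.cast '' S)
    (F.map Nat.castEmbedding)
  exact ⟨d, fun i hi => by simpa using hd i (by simpa using hi)⟩

/-! ### From nonresilience to finite trees -/

/-- An inconsistent family of instances along an indiscernible sequence is `k`-inconsistent for
some `k`. -/
theorem IndiscernibleOver.exists_kInconsistentFamily {I : Type*} [LinearOrder I]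
    {b : I → Fin n → M} {B : Set M} (hb : IndiscernibleOver L b B)
    (hcb : ¬ ConsistentFamily fun j => inst φ (b j)) :
    ∃ k, KInconsistentFamily k fun j => inst φ (b j) := by
  simp only [ConsistentFamily, not_forall] at hcb
  obtain ⟨s, hs⟩ := hcb
  -- One unrealized finite set decides for all sets of its size, by indiscernibility.
  refine ⟨s.card, fun t ht => ?_⟩
  have key (r : Finset I) (hr : r.card = s.card) : (∃ d : Fin m → M, ∀ i ∈ r, inst φ (b i) d) ↔
      (jointFormula φ (Fin s.card)).Realize (fun p => b (r.orderEmbOfFin hr p.1) p.2) := by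
    refine .trans ?_ (realize_jointFormula φ fun i => b (r.orderEmbOfFin hr i)).symm
    refine exists_congr fun d => ?_
    rw [← Set.forall_mem_range (f := r.orderEmbOfFin hr) (p := fun i => inst φ (b i) d)]
    simp
  rw [key t ht, ← hb.realize_iff (y := fun i => b (s.orderEmbOfFin rfl i))
    (z := fun i => b (t.orderEmbOfFin ht i)) _ (s.orderEmbOfFin rfl).strictMono
    (t.orderEmbOfFin ht).strictMono fun i => Or.inl ⟨i, rfl, rfl⟩, ← key s rfl]
  exact hs

/-- The formula over a branch of `l` tuples which says that above it there is a tree of height `h`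
in which every node has `w` successors, such that `φ` is `k`-inconsistent on the successors of each
node and consistent on each branch. -/
noncomputable def treeFormula (φ : L.Formula (Fin m ⊕ Fin n)) (k w : ℕ) :
    (h l : ℕ) → L.Formula (Fin l × Fin n)
  | 0, l => jointFormula φ (Fin l)
  | h + 1, l =>
    Formula.iExs (Fin w × Fin n)
      ((Formula.iInf fun s : {s : Finset (Fin w) // s.card = k} =>
          ∼((jointFormula φ s.1).relabel fun p => Sum.inr (p.1, p.2))) ⊓
        Formula.iInf fun j : Fin w => (treeFormula φ k w h (l + 1)).relabel fun p =>
          Fin.snoc (α := fun _ => Fin n → (Fin l × Fin n) ⊕ (Fin w × Fin n))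
            (fun i c => Sum.inl (i, c)) (fun c => Sum.inr (j, c)) p.1 p.2)

theorem realize_treeFormula_zero (k w l : ℕ) (y : Fin l → Fin n → M) :
    (treeFormula φ k w 0 l).Realize (fun p => y p.1 p.2) ↔
      ∃ d : Fin m → M, ∀ i, inst φ (y i) d :=
  realize_jointFormula φ y

theorem realize_treeFormula_succ (k w h l : ℕ) (y : Fin l → Fin n → M) :
    (treeFormula φ k w (h + 1) l).Realize (fun p => y p.1 p.2) ↔
      ∃ z : Fin w → Fin n → M, (KInconsistentFamily k fun j => inst φ (z j)) ∧
        ∀ j, (treeFormula φ k w h (l + 1)).Realize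
          (fun p => (Fin.snoc y (z j) : Fin (l + 1) → Fin n → M) p.1 p.2) := by
  rw [treeFormula, Formula.realize_iExs, (Equiv.curry (Fin w) (Fin n) M).exists_congr_left]
  refine exists_congr fun z => ?_
  rw [Formula.realize_inf, Formula.realize_iInf, Formula.realize_iInf]
  refine and_congr ?_ (forall_congr' fun j => ?_)
  · simp only [Subtype.forall, KInconsistentFamily, Formula.realize_not, Formula.realize_relabel]
    refine forall₂_congr fun s _ => not_congr ?_
    refine (realize_jointFormula φ fun i : s => z i).trans ?_
    simp
  · rw [Formula.realize_relabel]
    congr! 1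
    ext ⟨i, c⟩
    refine Fin.lastCases ?_ (fun i => ?_) i <;> simp

/-- The induction on the height needs the claim for every finite tuple from `a`: a branch extended
by `b j` is exchanged for one extended by `a 0`, which is again such a tuple. -/
theorem realize_treeFormula (ha : IndiscernibleOver L a ∅) (hab : a 0 = b 0)
    (hb : IndiscernibleOver L b {c | ∃ i : ℤ, i ≠ 0 ∧ ∃ j : Fin n, a i j = c})
    (hca : ConsistentFamily fun i : ℤ => inst φ (a i)) {k : ℕ}
    (hk : KInconsistentFamily k fun j : ℤ => inst φ (b j)) (w h l : ℕ) (f : Fin l → ℤ) :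
    (treeFormula φ k w h l).Realize (fun p => a (f p.1) p.2) := by
  induction h generalizing l f with
  | zero =>
    rw [realize_treeFormula_zero (φ := φ) k w l fun i => a (f i)]
    obtain ⟨d, hd⟩ := hca (Finset.univ.image f)
    exact ⟨d, fun i => hd _ (by simp)⟩
  | succ h ih =>
    obtain ⟨c, hc⟩ : ∃ c, ∀ i, f i < c := by
      obtain ⟨c, hc⟩ := (Set.finite_range f).bddAbove
      exact ⟨c + 1, fun i => Int.lt_add_one_of_le (hc ⟨i, rfl⟩)⟩
    -- After the shift the branch avoids index `0`, so replacing `a 0` by `b j` leaves it unchanged.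
    rw [ha.realize_shift _ f c, realize_treeFormula_succ k w h l fun i => a (f i - c)]
    refine ⟨fun j => b j, fun s hs => ?_, fun j => ?_⟩
    · have := hk (s.map ⟨fun j : Fin w => ((j : ℕ) : ℤ), fun _ _ h => by simpa [Fin.ext_iff] using h⟩)
        (by simpa using hs)
      simp only [Finset.forall_mem_map] at this
      exact this
    · have := (realize_update_iff hab hb (treeFormula φ k w h (l + 1))
        (Fin.snoc (fun i => f i - c) 0 : Fin (l + 1) → ℤ) j).1 (ih _ _)
      convert this using 1
      ext ⟨i, e⟩
      refine Fin.lastCases ?_ (fun i => ?_) i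
      · simp
      · simp [(sub_neg.2 (hc i)).ne]

/-- A tree with the properties which `treeFormula` expresses, indexed by finite sequences. -/
theorem exists_tree_of_realize_treeFormula [Nonempty M] {k w h l : ℕ} {y : Fin l → Fin n → M}
    (hy : (treeFormula φ k w h l).Realize fun p => y p.1 p.2) :
    ∃ e : List ℕ → Fin n → M,
      (∀ η : List ℕ, η.length < h → (∀ i ∈ η, i < w) → ∀ s : Finset ℕ, s.card = k →
        (∀ i ∈ s, i < w) → ¬ ∃ d : Fin m → M, ∀ i ∈ s, inst φ (e (η ++ [i])) d) ∧
      ∀ η : List ℕ, η.length = h → (∀ i ∈ η, i < w) → ∃ d : Fin m → M,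
        (∀ i, inst φ (y i) d) ∧ ∀ ζ : List ℕ, ζ ≠ [] → ζ <+: η → inst φ (e ζ) d := by
  induction h generalizing l y with
  | zero =>
    obtain ⟨d, hd⟩ := (realize_treeFormula_zero k w l y).1 hy
    refine ⟨fun _ _ => Classical.arbitrary M, by simp, fun η hη _ => ⟨d, hd, fun ζ h1 h2 => ?_⟩⟩
    rw [List.length_eq_zero_iff] at hη
    subst hη
    exact absurd (List.prefix_nil.1 h2) h1
  | succ h ih =>
    obtain ⟨z, hz, hyz⟩ := (realize_treeFormula_succ k w h l y).1 hy
    obtain ⟨z, rfl⟩ : ∃ z' : ℕ → Fin n → M, (fun j : Fin w => z' j) = z :=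
      ⟨fun j => if hj : j < w then z ⟨j, hj⟩ else fun _ => Classical.arbitrary M, by ext; simp⟩
    choose e he using fun j : Fin w => ih (hyz j)
    obtain ⟨e, rfl⟩ : ∃ e' : ℕ → List ℕ → Fin n → M, (fun j : Fin w => e' j) = e :=
      ⟨fun j => if hj : j < w then e ⟨j, hj⟩ else fun _ _ => Classical.arbitrary M, by
        ext; simp⟩
    -- The value at `[]` is arbitrary, as branches only constrain nonempty nodes. The root of the
    -- `j`-th subtree, arbitrary in `e j`, is filled with `z j`.
    refine ⟨fun ζ => match ζ with
      | [] => fun _ => Classical.arbitrary M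
      | j :: ζ => if ζ = [] then z j else e j ζ, fun η hη hηw s hs hsw => ?_, fun η hη hηw => ?_⟩
    · cases η with
      | nil =>
        have := hz (s.attachFin hsw) (by simpa using hs)
        refine mt (fun ⟨d, hd⟩ => ⟨d, fun i hi => ?_⟩) this
        simpa using hd i (Finset.mem_attachFin hsw |>.1 hi)
      | cons j η =>
        have hj : j < w := hηw j (by simp)
        simpa using (he ⟨j, hj⟩).1 η (by simpa using hη) (fun i hi => hηw i (by simp [hi])) s hs hsw
    · cases η with
      | nil => simp at hη
      | cons j η =>
        have hj : j < w := hηw j (by simp)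
        obtain ⟨d, hd, hd'⟩ := (he ⟨j, hj⟩).2 η (by simpa using hη)
          fun i hi => hηw i (by simp [hi])
        refine ⟨d, fun i => by simpa using hd i.castSucc, fun ζ hζ hζη => ?_⟩
        cases ζ with
        | nil => exact absurd rfl hζ
        | cons i ζ =>
          obtain ⟨rfl, hζη'⟩ := List.cons_prefix_cons.1 hζη
          by_cases hζ' : ζ = []
          · simpa [hζ'] using hd (Fin.last l)
          · simpa [hζ'] using hd' ζ hζ' hζη'

/-- A nonresilient configuration yields trees of all finite heights and widths. -/
theorem HasNonresilienceIn.exists_tree [Nonempty M] (h : HasNonresilienceIn M φ) :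
    ∃ k, ∀ N : ℕ, ∃ e : List ℕ → Fin n → M,
      (∀ η : List ℕ, η.length < N → (∀ i ∈ η, i < N) → ∀ s : Finset ℕ, s.card = k →
        (∀ i ∈ s, i < N) → ¬ ∃ d : Fin m → M, ∀ i ∈ s, inst φ (e (η ++ [i])) d) ∧
      ∀ η : List ℕ, η.length ≤ N → (∀ i ∈ η, i < N) → ∃ d : Fin m → M,
        ∀ ζ : List ℕ, ζ ≠ [] → ζ <+: η → inst φ (e ζ) d := by
  obtain ⟨a, b, ha, -, hab, hb, hca, hcb⟩ := h
  obtain ⟨k, hk⟩ := hb.exists_kInconsistentFamily hcb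
  refine ⟨k, fun N => ?_⟩
  obtain ⟨e, he, he'⟩ := exists_tree_of_realize_treeFormula (y := fun i : Fin 0 => a (i : ℕ))
    (realize_treeFormula ha hab hb hca hk N N 0 fun i => ((i : ℕ) : ℤ))
  refine ⟨e, he, fun η hη hηw => ?_⟩
  -- A short branch is padded with zeros to full height.
  obtain ⟨d, -, hd⟩ := he' (η ++ List.replicate (N - η.length) 0) (by simp; omega) fun i hi => by
    rcases List.mem_append.1 hi with hi | hi
    · exact hηw i hi
    · obtain ⟨h, rfl⟩ := List.mem_replicate.1 hi
      omega
  exact ⟨d, fun ζ h0 hζ => hd ζ h0 (hζ.trans (List.prefix_append _ _))⟩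

end Configuration

end Resilience

/-! ### Ultrapower limits and the tree property -/

section Compactness

variable {L : Language.{u, v}} {T : L.Theory} {m n : ℕ}

open Filter

/-- A family of `n`-tuples in a model which depends on a parameter has a limit along any
ultrafilter, in another model, namely the ultrapower. -/
theorem exists_limit_model (M : Theory.ModelType.{u, v, max u v} T) {ι : Type (max u v)}
    (F : Ultrafilter ι) {κ : Type*} (y : ι → κ → Fin n → M) :
    ∃ (N : Theory.ModelType.{u, v, max u v} T) (z : κ → Fin n → N),
      ∀ ψ : L.Formula (κ × Fin n), ψ.Realize (fun p => z p.1 p.2) ↔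
        ∀ᶠ i in F, ψ.Realize (fun p => y i p.1 p.2) := by
  have hT : T.Model ((F : Filter ι).Product fun _ => M) :=
    ⟨fun ψ hψ => (Ultraproduct.sentence_realize ψ).2
      (Eventually.of_forall fun _ => Theory.realize_sentence_of_mem T hψ)⟩
  refine ⟨⟨(F : Filter ι).Product fun _ => M⟩,
    fun k j => ((fun i => y i k j : ι → M) : (F : Filter ι).Product fun _ => M), fun ψ => ?_⟩
  exact Ultraproduct.realize_formula_cast ψ fun p i => y i p.1 p.2

theorem HasNonresilienceIn.exists_hasTPIn {φ : L.Formula (Fin m ⊕ Fin n)}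
    {M : Theory.ModelType.{u, v, max u v} T} (h : HasNonresilienceIn M φ) :
    ∃ N : Theory.ModelType.{u, v, max u v} T, HasTPIn N φ := by
  obtain ⟨k, hk⟩ := h.exists_tree
  choose e he he' using hk
  obtain ⟨N, z, hz⟩ := exists_limit_model M ((hyperfilter ℕ).map ULift.up)
    fun i : ULift.{max u v} ℕ => e i.down
  simp only [Ultrafilter.coe_map, eventually_map] at hz
  have ev : ∀ p : ℕ → Prop, (∃ b, ∀ i ≥ b, p i) → ∀ᶠ i in hyperfilter ℕ, p i := fun p hp =>
    Nat.hyperfilter_le_atTop (eventually_atTop.2 hp)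
  -- The root of the finite trees carries no condition, whereas the tree property includes the root
  -- in every branch; hence the subtree above the node `[0]`.
  refine ⟨N, fun η => z (0 :: η), k, fun η s hs => ?_, fun σ s => ?_⟩
  · have := (hz (∼((jointFormula φ s).relabel fun p => (0 :: η ++ [(p.1 : ℕ)], p.2)))).2 ?_
    · rw [Formula.realize_not, Formula.realize_relabel] at this
      refine mt (fun ⟨d, hd⟩ => ?_) this
      exact (realize_jointFormula φ fun i : s => z (0 :: η ++ [(i : ℕ)])).2 ⟨d, fun i => hd i i.2⟩
    -- The bound exceeds the length of `0 :: η`, all its entries, and all members of `s`.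
    · refine ev _ ⟨η.length + η.sum + s.sup id + 2, fun i hi => ?_⟩
      rw [Formula.realize_not, Formula.realize_relabel]
      refine mt (realize_jointFormula φ fun j : s => e i (0 :: η ++ [(j : ℕ)])).1 ?_
      have := he i (0 :: η) (by simp; omega) (fun j hj => ?_) s hs fun j hj => ?_
      · simpa using this
      · rcases List.mem_cons.1 hj with rfl | hj
        · omega
        · have := List.le_sum_of_mem hj
          omega
      · have := Finset.le_sup (f := id) hj
        simp only [id] at this
        omega
  · have := (hz ((jointFormula φ s).relabel fun p => (0 :: (List.range p.1).map σ, p.2))).2 ?_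
    · rw [Formula.realize_relabel] at this
      obtain ⟨d, hd⟩ := (realize_jointFormula φ fun i : s => z (0 :: (List.range i).map σ)).1 this
      exact ⟨d, fun i hi => hd ⟨i, hi⟩⟩
    · refine ev _ ⟨s.sup id + (List.map σ (List.range (s.sup id))).sum + 1, fun i hi => ?_⟩
      rw [Formula.realize_relabel]
      refine (realize_jointFormula φ fun l : s => e i (0 :: (List.range l).map σ)).2 ?_
      obtain ⟨d, hd⟩ := he' i (0 :: (List.range (s.sup id)).map σ) (by simp; omega) fun j hj => by
        rcases List.mem_cons.1 hj with rfl | hj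
        · omega
        · have := List.le_sum_of_mem hj
          omega
      refine ⟨d, fun l => hd _ (by simp) (List.cons_prefix_cons.2 ⟨rfl, ?_⟩)⟩
      rw [← Nat.add_sub_of_le (Finset.le_sup (f := id) l.2), List.range_add, List.map_append]
      exact List.prefix_append _ _

end Compactness

/-! ### Iterated sampling from an ultrafilter -/

section Sampling

open Filter Function

variable {X I : Type*}

/-- The `k`-fold product of an ultrafilter, whose first coordinate is sampled first. -/
def ultrafilterPower (p : Ultrafilter X) : (k : ℕ) → Ultrafilter (Fin k → X)
  | 0 => pure Fin.elim0
  | k + 1 => p.bind fun x => (ultrafilterPower p k).map (Fin.cons x)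

/-- The ultrafilter of functions obtained from `v` by resampling from `p`, one after the other, the
values at the members of a list. -/
def resample [DecidableEq I] (p : Ultrafilter X) : List I → (I → X) → Ultrafilter (I → X)
  | [], v => pure v
  | i :: l, v => p.bind fun x => resample p l (update v i x)

theorem eventually_ultrafilterPower_succ {p : Ultrafilter X} {k : ℕ} {P : (Fin (k + 1) → X) → Prop} :
    (∀ᶠ w in ultrafilterPower p (k + 1), P w) ↔
      ∀ᶠ x in p, ∀ᶠ w in ultrafilterPower p k, P (Fin.cons x w) :=
  Iff.rfl

section

variable [DecidableEq I] {p : Ultrafilter X} {l l' : List I} {v : I → X} {P : (I → X) → Prop}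

theorem eventually_resample_nil : (∀ᶠ w in resample p [] v, P w) ↔ P v :=
  Iff.rfl

theorem eventually_resample_cons {i : I} : (∀ᶠ w in resample p (i :: l) v, P w) ↔
    ∀ᶠ x in p, ∀ᶠ w in resample p l (update v i x), P w :=
  Iff.rfl

theorem eventually_resample_append : (∀ᶠ w in resample p (l ++ l') v, P w) ↔
    ∀ᶠ v' in resample p l v, ∀ᶠ w in resample p l' v', P w := by
  induction l generalizing v with
  | nil => rfl
  | cons i l ih => simp only [List.cons_append, eventually_resample_cons, ih]

theorem eventually_resample_update {i : I} (hi : i ∉ l) (x : X) :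
    (∀ᶠ w in resample p l (update v i x), P w) ↔
      ∀ᶠ w in resample p l v, P (update w i x) := by
  induction l generalizing v with
  | nil => rfl
  | cons j l ih =>
    simp only [List.mem_cons, not_or] at hi
    simp only [eventually_resample_cons, ← ih hi.2, update_comm hi.1]

/-- If almost every point for `p` lies in some `g r`, with `r` outside any given finite set, then
almost every sample lies in sets `g r` with distinct `r`. -/
theorem eventually_resample_injOn {g : ℕ → Set X}
    (hp : ∀ F : Finset ℕ, ∀ᶠ x in p, ∃ r ∉ F, x ∈ g r) (hl : l.Nodup) (F : Finset ℕ) :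
    ∀ᶠ w : I → X in resample p l v, ∃ R : I → ℕ, Set.InjOn R {i | i ∈ l} ∧
      ∀ i ∈ l, R i ∉ F ∧ w i ∈ g (R i) := by
  induction l generalizing v F with
  | nil => exact eventually_resample_nil.2 ⟨fun _ => 0, by simp, by simp⟩
  | cons i l ih =>
    rw [List.nodup_cons] at hl
    rw [eventually_resample_cons]
    filter_upwards [hp F] with x ⟨r, hr, hx⟩
    rw [eventually_resample_update hl.1]
    filter_upwards [ih (v := v) hl.2 (insert r F)] with w ⟨R, hR, hw⟩
    have hne : ∀ j ∈ l, j ≠ i := fun j hj h => hl.1 (h ▸ hj)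
    have hRr : ∀ j ∈ l, R j ≠ r := fun j hj h => (hw j hj).1 (h ▸ Finset.mem_insert_self _ _)
    refine ⟨update R i r, ?_, ?_⟩
    · intro j hj j' hj' h
      rcases List.mem_cons.1 hj with rfl | hjl <;> rcases List.mem_cons.1 hj' with rfl | hjl'
      · rfl
      · rw [update_self, update_of_ne (hne _ hjl')] at h
        exact absurd h.symm (hRr _ hjl')
      · rw [update_self, update_of_ne (hne _ hjl)] at h
        exact absurd h (hRr _ hjl)
      · rw [update_of_ne (hne _ hjl), update_of_ne (hne _ hjl')] at h
        exact hR hjl hjl' h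
    · intro j hj
      rcases List.mem_cons.1 hj with rfl | hj
      · simpa using ⟨hr, hx⟩
      · simp only [update_of_ne (hne _ hj)]
        exact ⟨fun h => (hw j hj).1 (Finset.mem_insert_of_mem h), (hw j hj).2⟩

end

variable [LinearOrder I] {p : Ultrafilter X} {l : List I} {v : I → X}

/-- The source of indiscernibility: coordinates outside the range of `s` integrate out, and the
others are sampled in increasing order, so only `k` matters. -/
theorem eventually_resample_comp (hl : l.Pairwise (· < ·)) {k : ℕ} {s : Fin k → I}
    (hs : StrictMono s) (hsl : ∀ q, s q ∈ l) {P : (Fin k → X) → Prop} :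
    (∀ᶠ w : I → X in resample p l v, P (w ∘ s)) ↔ ∀ᶠ w in ultrafilterPower p k, P w := by
  induction l generalizing k v with
  | nil =>
    cases k with
    | zero =>
      rw [eventually_resample_nil, Subsingleton.elim (v ∘ s) Fin.elim0]
      rfl
    | succ k => simpa using hsl 0
  | cons i l ih =>
    rw [List.pairwise_cons] at hl
    have hil : i ∉ l := fun h => (hl.1 i h).false
    simp only [eventually_resample_cons]
    by_cases hi : ∃ q, s q = i
    · obtain ⟨q, hq⟩ := hi
      cases k with
      | zero => exact q.elim0
      | succ k =>
        -- `i` is the least member of the list, so it can only be the first value of `s`.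
        have h0 : s 0 = i := by
          rcases List.mem_cons.1 (hsl 0) with h | h
          · exact h
          · exact absurd (hs.monotone (Fin.zero_le q)) (by rw [hq]; exact (hl.1 _ h).not_ge)
        have hne (q : Fin k) : s q.succ ≠ i := h0 ▸ (hs q.succ_pos).ne'
        rw [eventually_ultrafilterPower_succ]
        refine eventually_congr (.of_forall fun x => ?_)
        rw [eventually_resample_update hil,
          ← ih hl.2 (v := v) (s := s ∘ Fin.succ) (hs.comp (Fin.strictMono_succ))
            (fun q => (List.mem_cons.1 (hsl _)).resolve_left (hne q))]
        refine eventually_congr (.of_forall fun w => iff_of_eq (congrArg P ?_))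
        ext q
        refine Fin.cases ?_ (fun q => ?_) q
        · simp [h0]
        · simp [hne]
    · push Not at hi
      simp only [ih hl.2 hs fun q => (List.mem_cons.1 (hsl q)).resolve_left (hi q)]
      exact eventually_const

theorem eventually_resample_apply (hl : l.Pairwise (· < ·)) {i : I} (hi : i ∈ l) {P : X → Prop} :
    (∀ᶠ w : I → X in resample p l v, P (w i)) ↔ ∀ᶠ x in p, P x :=
  (eventually_resample_comp hl (k := 1) (s := fun _ => i) (Subsingleton.strictMono _)
    (fun _ => hi) (P := fun w => P (w 0))).trans Iff.rfl

end Sampling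

/-! ### Generic rows and columns of an array -/

section Array

open Filter Function

variable {X : Type*}

/-- The increasing list of the integers from `-N` to `-1`. -/
noncomputable def negList (N : ℕ) : List ℤ := (Finset.Ico (-N : ℤ) 0).sort

/-- The increasing list of the integers from `1` to `N`. -/
noncomputable def posList (N : ℕ) : List ℤ := (Finset.Ioc 0 (N : ℤ)).sort

theorem mem_negList {N : ℕ} {i : ℤ} : i ∈ negList N ↔ -N ≤ i ∧ i < 0 := by simp [negList]

theorem mem_posList {N : ℕ} {i : ℤ} : i ∈ posList N ↔ 0 < i ∧ i ≤ N := by simp [posList]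

/-- The increasing list of the integers from `-N` to `N`. -/
noncomputable def symmList (N : ℕ) : List ℤ := negList N ++ 0 :: posList N

theorem mem_symmList {N : ℕ} {i : ℤ} : i ∈ symmList N ↔ -N ≤ i ∧ i ≤ N := by
  simp only [symmList, List.mem_append, List.mem_cons, mem_negList, mem_posList]
  omega

theorem pairwise_symmList (N : ℕ) : (symmList N).Pairwise (· < ·) := by
  rw [symmList, List.pairwise_append, List.pairwise_cons]
  refine ⟨(Finset.sortedLT_sort _).pairwise, ⟨fun i hi => (mem_posList.1 hi).1,
    (Finset.sortedLT_sort _).pairwise⟩, fun i hi j hj => ?_⟩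
  rw [mem_negList] at hi
  rw [List.mem_cons, mem_posList] at hj
  omega

/-- The ultrafilter of the elements of an array in a generic column of a generic row. -/
noncomputable def arrayUltrafilter (a : ℕ → ℕ → X) : Ultrafilter X :=
  (hyperfilter ℕ).bind fun r => (hyperfilter ℕ).map (a r)

/-- The ultrafilter of the pairs of a sequence with values in generic rows of an array, and a
sequence of elements of a single row, which agree at `0`; generic values are taken only at the
integers from `-N` to `N`. -/
noncomputable def crossUltrafilter (a : ℕ → ℕ → X) (N : ℕ) : Ultrafilter ((ℤ → X) × (ℤ → X)) :=
  (resample (arrayUltrafilter a) (negList N) fun _ => a 0 0).bind fun v =>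
    -- The row `r` is chosen between the negative and the positive coordinates, and the latter are
    -- sampled independently of `r` and `w`.
    (hyperfilter ℕ).bind fun r =>
      (resample ((hyperfilter ℕ).map (a r)) (symmList N) fun _ => a 0 0).bind fun w =>
        (resample (arrayUltrafilter a) (posList N) v).map fun v' => (update v' 0 (w 0), w)

variable {a : ℕ → ℕ → X} {N : ℕ}

theorem eventually_crossUltrafilter {P : (ℤ → X) × (ℤ → X) → Prop} :
    (∀ᶠ y : (ℤ → X) × (ℤ → X) in crossUltrafilter a N, P y) ↔
      ∀ᶠ v in resample (arrayUltrafilter a) (negList N) fun _ => a 0 0,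
        ∀ᶠ r in hyperfilter ℕ,
          ∀ᶠ w in resample ((hyperfilter ℕ).map (a r)) (symmList N) fun _ => a 0 0,
            ∀ᶠ v' in resample (arrayUltrafilter a) (posList N) v, P (update v' 0 (w 0), w) :=
  Iff.rfl

/-- A generic column of the generic row `r` is a sample from `arrayUltrafilter a`, so the value
inserted at `0` has the same law as the other coordinates. -/
theorem eventually_crossUltrafilter_fst {P : (ℤ → X) → Prop} :
    (∀ᶠ y : (ℤ → X) × (ℤ → X) in crossUltrafilter a N, P y.1) ↔
      ∀ᶠ v in resample (arrayUltrafilter a) (symmList N) fun _ => a 0 0, P v := by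
  rw [eventually_crossUltrafilter, symmList, eventually_resample_append]
  refine eventually_congr (.of_forall fun v => ?_)
  rw [eventually_resample_cons]
  have h0 : (0 : ℤ) ∉ posList N := by simp [mem_posList]
  simp only [eventually_resample_update h0]
  refine .trans (eventually_congr (.of_forall fun r => ?_)) Iff.rfl
  exact eventually_resample_apply (pairwise_symmList N) (mem_symmList.2 (by simp))
    (P := fun x => ∀ᶠ v' in resample (arrayUltrafilter a) (posList N) v, P (update v' 0 x))

/-- Overwriting coordinate `0` removes the only dependence of the first sequence on `w`. The right
side does not mention `s`, which gives indiscernibility of the second sequence over the rest of the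
first. -/
theorem eventually_crossUltrafilter_snd_comp {k : ℕ} {s : Fin k → ℤ} (hs : StrictMono s)
    (hsN : ∀ q, s q ∈ symmList N) {P : (Fin k → X) → (ℤ → X) → Prop} :
    (∀ᶠ y : (ℤ → X) × (ℤ → X) in crossUltrafilter a N, P (y.2 ∘ s) (update y.1 0 (a 0 0))) ↔
      ∀ᶠ v in resample (arrayUltrafilter a) (negList N) fun _ => a 0 0,
        ∀ᶠ r in hyperfilter ℕ, ∀ᶠ w in ultrafilterPower ((hyperfilter ℕ).map (a r)) k,
            ∀ᶠ v' in resample (arrayUltrafilter a) (posList N) v, P w (update v' 0 (a 0 0)) := by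
  rw [eventually_crossUltrafilter]
  simp only [update_idem]
  refine eventually_congr (.of_forall fun v => eventually_congr (.of_forall fun r => ?_))
  exact eventually_resample_comp (pairwise_symmList N) hs hsN (P := fun w =>
    ∀ᶠ v' in resample (arrayUltrafilter a) (posList N) v, P w (update v' 0 (a 0 0)))

theorem eventually_crossUltrafilter_agree : ∀ᶠ y : (ℤ → X) × (ℤ → X) in crossUltrafilter a N, y.1 0 = y.2 0 := by
  rw [eventually_crossUltrafilter]
  simp

/-- Almost always, the first sequence takes its values in distinct rows. -/
theorem eventually_crossUltrafilter_rows : ∀ᶠ y : (ℤ → X) × (ℤ → X) in crossUltrafilter a N,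
    ∃ R C : ℤ → ℕ, Set.InjOn R {i | i ∈ symmList N} ∧ ∀ i ∈ symmList N, y.1 i = a (R i) (C i) := by
  rw [eventually_crossUltrafilter_fst (P := fun y => ∃ R C : ℤ → ℕ,
    Set.InjOn R {i | i ∈ symmList N} ∧ ∀ i ∈ symmList N, y i = a (R i) (C i))]
  have := eventually_resample_injOn (p := arrayUltrafilter a) (v := fun _ => a 0 0)
    (g := fun r => Set.range (a r)) (fun F => ?_) (pairwise_symmList N).nodup ∅
  · filter_upwards [this] with v ⟨R, hR, hv⟩
    choose! C hC using fun i hi => (hv i hi).2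
    exact ⟨R, C, hR, fun i hi => (hC i hi).symm⟩
  · change ∀ᶠ r : ℕ in hyperfilter ℕ, ∀ᶠ j : ℕ in hyperfilter ℕ, ∃ s ∉ F, a r j ∈ Set.range (a s)
    filter_upwards [(F.finite_toSet).compl_mem_hyperfilter] with r hr
    exact .of_forall fun j => ⟨r, hr, j, rfl⟩

/-- Almost always, the second sequence takes its values in distinct columns of a single row. -/
theorem eventually_crossUltrafilter_columns : ∀ᶠ y : (ℤ → X) × (ℤ → X) in crossUltrafilter a N,
    ∃ (r : ℕ) (C : ℤ → ℕ), Set.InjOn C {i | i ∈ symmList N} ∧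
      ∀ i ∈ symmList N, y.2 i = a r (C i) := by
  rw [eventually_crossUltrafilter]
  refine .of_forall fun v => .of_forall fun r => ?_
  have := eventually_resample_injOn (p := (hyperfilter ℕ).map (a r)) (v := fun _ => a 0 0)
    (g := fun j => {a r j}) (fun F => ?_) (pairwise_symmList N).nodup ∅
  · filter_upwards [this] with w ⟨C, hC, hw⟩
    exact .of_forall fun v' => ⟨r, C, hC, fun i hi => (hw i hi).2⟩
  · change ∀ᶠ j : ℕ in hyperfilter ℕ, ∃ s ∉ F, a r j ∈ ({a r s} : Set X)
    filter_upwards [(F.finite_toSet).compl_mem_hyperfilter] with j hj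
    exact ⟨j, hj, rfl⟩

end Array

/-! ### From TP₂ to nonresilience in the limit -/

section ArrayLimit

open Filter Function

variable {L : Language.{u, v}}

theorem IndiscernibleOver.mono {M : Type w} [L.Structure M] {n : ℕ} {I : Type*} [LinearOrder I]
    {a : I → Fin n → M} {B C : Set M} (ha : IndiscernibleOver L a B) (h : C ⊆ B) :
    IndiscernibleOver L a C := by
  intro k ψ s t hs ht
  have := ha k (ψ.relabel (Sum.map id (Set.inclusion h))) s t hs ht
  rw [Formula.realize_relabel, Formula.realize_relabel, Sum.elim_comp_map, Sum.elim_comp_map] at this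
  exact this

/-- Indiscernibility over a set which is enumerated by a family of parameters. -/
theorem indiscernibleOver_of_enumeration {M : Type w} [L.Structure M] {n : ℕ} {I γ : Type*}
    [LinearOrder I] {a : I → Fin n → M} {B : Set M} (c : γ → M) (hc : B ⊆ Set.range c)
    (h : ∀ (k : ℕ) (ψ : L.Formula ((Fin k × Fin n) ⊕ γ)) (s t : Fin k → I),
      StrictMono s → StrictMono t →
        (ψ.Realize (Sum.elim (fun p => a (s p.1) p.2) c) ↔
          ψ.Realize (Sum.elim (fun p => a (t p.1) p.2) c))) :
    IndiscernibleOver L a B := by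
  intro k ψ s t hs ht
  choose g hg using fun x : B => hc x.2
  have := h k (ψ.relabel (Sum.map id g)) s t hs ht
  rw [Formula.realize_relabel, Formula.realize_relabel, Sum.elim_comp_map, Sum.elim_comp_map,
    show c ∘ g = (fun x : B => (x : M)) from funext hg] at this
  exact this

variable {T : L.Theory} {m n : ℕ}

theorem eventually_mem_symmList {ι : Type*} [Finite ι] (f : ι → ℤ) :
    ∀ᶠ N : ℕ in hyperfilter ℕ, ∀ i, f i ∈ symmList N := by
  refine Nat.hyperfilter_le_atTop (eventually_all.2 fun i => ?_)
  filter_upwards [eventually_ge_atTop (f i).natAbs] with N hN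
  rw [mem_symmList]
  omega

theorem HasTP2In.exists_hasNonresilienceIn {φ : L.Formula (Fin m ⊕ Fin n)}
    {M : Theory.ModelType.{u, v, max u v} T} (h : HasTP2In M φ) :
    ∃ N : Theory.ModelType.{u, v, max u v} T, HasNonresilienceIn N φ := by
  obtain ⟨e, k, hk, hf⟩ := h
  obtain ⟨N, z, hz⟩ := exists_limit_model M ((hyperfilter ℕ).bind (crossUltrafilter e))
    (fun y => (Sum.elim y.1 y.2 : ℤ ⊕ ℤ → Fin n → M))
  replace hz : ∀ ψ : L.Formula ((ℤ ⊕ ℤ) × Fin n), ψ.Realize (fun p => z p.1 p.2) ↔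
      ∀ᶠ K : ℕ in hyperfilter ℕ, ∀ᶠ y : (ℤ → Fin n → M) × (ℤ → Fin n → M) in crossUltrafilter e K,
        ψ.Realize (fun p => (Sum.elim y.1 y.2 : ℤ ⊕ ℤ → Fin n → M) p.1 p.2) := hz
  have hab : z (Sum.inl 0) = z (Sum.inr 0) := by
    ext j
    have := (hz ((Term.var (Sum.inl 0, j)).equal (Term.var (Sum.inr 0, j)))).2 <|
      .of_forall fun K => eventually_crossUltrafilter_agree.mono fun y hy => by simp [hy]
    simpa using this
  have ha : IndiscernibleOver L (fun i => z (Sum.inl i)) ∅ := by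
    refine indiscernibleOver_of_enumeration (γ := Empty) Empty.elim (by simp)
      fun k ψ s t hs ht => ?_
    have key (s : Fin k → ℤ) (hs : StrictMono s) :
        ψ.Realize (Sum.elim (fun p => z (Sum.inl (s p.1)) p.2) Empty.elim) ↔
          ∀ᶠ x : Fin k → Fin n → M in ultrafilterPower (arrayUltrafilter e) k,
            ψ.Realize (Sum.elim (fun p => x p.1 p.2) Empty.elim) := by
      have h1 := hz (ψ.relabel (Sum.elim (fun p => (Sum.inl (s p.1), p.2)) Empty.elim))
      simp only [Formula.realize_relabel] at h1
      refine .trans (iff_of_eq ?_) (h1.trans (.trans (eventually_congr ?_) eventually_const))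
      · congr 1; ext (_ | x); exacts [rfl, x.elim]
      · filter_upwards [eventually_mem_symmList s] with K hK
        rw [← eventually_resample_comp (v := fun _ => e 0 0) (pairwise_symmList K) hs hK,
          ← eventually_crossUltrafilter_fst]
        refine eventually_congr (.of_forall fun y => iff_of_eq ?_)
        congr 1; ext (_ | x); exacts [rfl, x.elim]
    rw [key s hs, key t ht]
  have hb : IndiscernibleOver L (fun i => z (Sum.inr i))
      {c | ∃ i : ℤ, i ≠ 0 ∧ ∃ j : Fin n, z (Sum.inl i) j = c} := by
    refine indiscernibleOver_of_enumeration (γ := {i : ℤ // i ≠ 0} × Fin n)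
      (fun p => z (Sum.inl p.1) p.2)
      (by rintro _ ⟨i, hi, j, rfl⟩; exact ⟨(⟨i, hi⟩, j), rfl⟩) fun k ψ s t hs ht => ?_
    have key (s : Fin k → ℤ) :
        ψ.Realize (Sum.elim (fun p => z (Sum.inr (s p.1)) p.2) fun p => z (Sum.inl p.1) p.2) ↔
          ∀ᶠ K : ℕ in hyperfilter ℕ,
            ∀ᶠ y : (ℤ → Fin n → M) × (ℤ → Fin n → M) in crossUltrafilter e K,
              ψ.Realize (Sum.elim (fun p => (y.2 ∘ s) p.1 p.2)
                -- The parameters avoid index `0`, so the value there may be overwritten.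
                fun p => update y.1 0 (e 0 0) p.1 p.2) := by
      have h1 := hz (ψ.relabel (Sum.elim (fun p => (Sum.inr (s p.1), p.2))
        fun p => (Sum.inl p.1, p.2)))
      simp only [Formula.realize_relabel] at h1
      refine .trans (iff_of_eq ?_) (h1.trans (eventually_congr (.of_forall fun K =>
        eventually_congr (.of_forall fun y => iff_of_eq ?_))))
      · congr 1; ext (_ | _) <;> rfl
      · congr 1
        ext (_ | ⟨⟨i, hi⟩, j⟩)
        · rfl
        · simp [hi]
    rw [key s, key t]
    refine eventually_congr ?_
    filter_upwards [eventually_mem_symmList s, eventually_mem_symmList t] with K hs' ht'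
    have h1 := fun (s : Fin k → ℤ) (hs : StrictMono s) (hsK : ∀ q, s q ∈ symmList K) =>
      eventually_crossUltrafilter_snd_comp (a := e) hs hsK (P := fun x v =>
        ψ.Realize (Sum.elim (fun p => x p.1 p.2) fun p => v p.1 p.2))
    rw [h1 s hs hs', h1 t ht ht']
  have hca : ConsistentFamily fun i : ℤ => inst φ (z (Sum.inl i)) := by
    intro s
    have := (hz ((jointFormula φ s).relabel fun p => (Sum.inl p.1, p.2))).2 ?_
    · rw [Formula.realize_relabel] at this
      obtain ⟨d, hd⟩ := (realize_jointFormula φ fun i : s => z (Sum.inl i)).1 this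
      exact ⟨d, fun i hi => hd ⟨i, hi⟩⟩
    · filter_upwards [eventually_mem_symmList fun i : s => (i : ℤ)] with K hK
      filter_upwards [eventually_crossUltrafilter_rows] with y ⟨R, C, hR, hy⟩
      rw [Formula.realize_relabel]
      refine (realize_jointFormula φ fun i : s => y.1 i).2 ?_
      -- Since the rows `R i` are distinct, some path through the array passes through column `C i`
      -- of row `R i` for every sampled `i`.
      obtain ⟨d, hd⟩ := hf (fun r => C (invFunOn R {i | i ∈ symmList K} r)) (s.image R)
      refine ⟨d, fun i => ?_⟩
      have := hd (R i) (Finset.mem_image_of_mem R i.2)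
      beta_reduce at this
      rwa [hR.leftInvOn_invFunOn (hK i), ← hy _ (hK i)] at this
  have hcb : ¬ ConsistentFamily fun j : ℤ => inst φ (z (Sum.inr j)) := by
    intro h
    obtain ⟨d, hd⟩ := h ((Finset.range k).map Nat.castEmbedding)
    set s := (Finset.range k).map (Nat.castEmbedding (R := ℤ))
    have := (hz ((jointFormula φ s).relabel fun p => (Sum.inr p.1, p.2))).1 (by
      rw [Formula.realize_relabel]
      exact (realize_jointFormula φ fun i : s => z (Sum.inr i)).2 ⟨d, fun i => hd i i.2⟩)
    obtain ⟨K, hK, hsK⟩ := (this.and (eventually_mem_symmList fun i : s => (i : ℤ))).exists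
    obtain ⟨y, hy, r, C, hC, hyC⟩ := (hK.and eventually_crossUltrafilter_columns).exists
    rw [Formula.realize_relabel] at hy
    obtain ⟨d, hd⟩ := (realize_jointFormula φ fun i : s => y.2 i).1 hy
    -- The `k` columns are distinct, so `d` would realize `k` instances from row `r`.
    refine hk r (s.image C) ?_ ⟨d, ?_⟩
    · rw [Finset.card_image_of_injOn fun i hi j hj h => hC (hsK ⟨i, hi⟩) (hsK ⟨j, hj⟩) h]
      simp [s]
    · rw [Finset.forall_mem_image]
      intro i hi
      rw [← hyC i (hsK ⟨i, hi⟩)]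
      exact hd ⟨i, hi⟩
  exact ⟨N, fun i => z (Sum.inl i), fun i => z (Sum.inr i), ha, hb.mono (Set.empty_subset _), hab,
    hb, hca, hcb⟩

end ArrayLimit

end FirstOrder.Language

theorem mainTheorem6 {L : FirstOrder.Language.{u, v}} (T : L.Theory) (hT : T.IsComplete) :
    (T.IsNIP → T.IsResilient) ∧
    (T.IsSimple → T.IsResilient) ∧
    (T.IsResilient → T.IsNTP2) := by
  refine ⟨fun h m n φ M hM => h m n φ M hM.hasIPIn, fun h m n φ M hM => ?_, fun h m n φ M hM => ?_⟩
  · obtain ⟨N, hN⟩ := hM.exists_hasTPIn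
    exact h m n φ N hN
  · obtain ⟨N, hN⟩ := hM.exists_hasNonresilienceIn
    exact h m n φ N hN
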